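/- For $p,q>0$ let $P_{pq}$ be the beta distribution on $[0,1]$ with parameters $p,q$ (so $P_{11}$ is the uniform distribution) and put $\tau(p,q)=2p^2-2pq-q^2+2p-q$. Based on an i.i.d. sample $X_1,\dots,X_n$, the hypothesis of uniformity $P=P_{11}$ is tested by the two upper-tailed tests with statistics $T_n=n^{-1/2}\sum_{i=1}^n (X_i^2-1/3)$ and $V_n=\sqrt n\,(\bar X-1/2)$: the test based on $W\in\{T,V\}$ at level $\alpha$ rejects when $W_n>w_{\alpha,n}$, where $w_{\alpha,n}$ is the exact critical value, i.e. the smallest $t$ with $P_{11}^n(W_n>t)\le\alpha$. For $0<\alpha<\beta<1$ and an alternative $P$ let $N_W(\alpha,\beta,P)$ be the minimal sample size $N\ge 1$ such that $P^n(W_n>w_{\alpha,n})\ge\beta$ for all $n\ge N$ ($\infty$ if there is none). Let $p>q>0$ with $\tau(p,q)>0$, and consider the linear contamination path $P_s=(1-s)P_{11}+sP_{pq}$, $s\in[0,1]$. Then $(P_s)$ is a path starting at $P_{11}$, that is, the $P_s$ are probability distributions with $P_0=P_{11}$, dominated by a common $\sigma$-finite measure, and the Hellinger distance of $P_s$ and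 $P_{11}$ tends to $0$ as $s\to0^+$. Moreover, for all $0<\alpha<\beta<1$ the Pitman efficiency of $T$ with respect to $V$ along this path exists, does not depend on $\alpha,\beta$, and equals $$\lim_{s\to0^+}\frac{N_V(\alpha,\beta,P_s)}{N_T(\alpha,\beta,P_s)}=\frac{5\,\tau(p,q)^2}{12\,(p-q)^2(p+q+1)^2}.$$ -/

import Mathlib

open MeasureTheory ProbabilityTheory Filter Topology
open scoped ENNReal

namespace Pitman

noncomputable section

variable {𝓧 : Type*} [MeasurableSpace 𝓧]

/-- The law `P^n` of an i.i.d. sample of size `n` from `P`. -/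
def sampleLaw (P : Measure 𝓧) (n : ℕ) : Measure (Fin n → 𝓧) :=
  Measure.pi (fun _ => P)

/-- The exact critical value at level `α` of the upper-tailed test that rejects for large values of
`W n`: the smallest `t` such that, under the null distribution `P₀`, `W n > t` has probability at
most `α`. -/
def criticalValue (P₀ : Measure 𝓧) (W : (n : ℕ) → (Fin n → 𝓧) → ℝ) (α : ℝ) (n : ℕ) : ℝ :=
  sInf {t : ℝ | (sampleLaw P₀ n).real {x | t < W n x} ≤ α}

/-- Power, at the alternative `P` and sample size `n`, of the upper-tailed level `α` test of `P₀`
based on `W`. -/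
def power (P₀ : Measure 𝓧) (W : (n : ℕ) → (Fin n → 𝓧) → ℝ) (α : ℝ) (P : Measure 𝓧) (n : ℕ) : ℝ :=
  (sampleLaw P n).real {x | criticalValue P₀ W α n < W n x}

/-- `N_W(α, β, P)`: the minimal sample size `N ≥ 1` such that for all `n ≥ N` the power at `P` is
at least `β` (and `∞` if there is no such `N`). -/
def minSampleSize (P₀ : Measure 𝓧) (W : (n : ℕ) → (Fin n → 𝓧) → ℝ) (α β : ℝ) (P : Measure 𝓧) :
    ℝ≥0∞ :=
  ⨅ (N : ℕ) (_ : 1 ≤ N ∧ ∀ n : ℕ, N ≤ n → β ≤ power P₀ W α P n), (N : ℝ≥0∞)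

/-- Relative efficiency `N_V / N_T` of `T` with respect to `V` at the alternative `P`. (The value
is in `(0, ∞)` if and only if both sample sizes are finite.) -/
def relativeEfficiency (P₀ : Measure 𝓧) (T V : (n : ℕ) → (Fin n → 𝓧) → ℝ) (α β : ℝ)
    (P : Measure 𝓧) : ℝ≥0∞ :=
  minSampleSize P₀ V α β P / minSampleSize P₀ T α β P

/-- Hellinger distance, `H(P, Q)² = ∫ (√p - √q)² dλ` for densities `p, q` with respect to a common
dominating measure `λ`; the value does not depend on `λ`, and `λ = P + Q` is used. -/
def hellingerDist (P Q : Measure 𝓧) : ℝ :=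
  √(∫ x, (√(P.rnDeriv (P + Q) x).toReal - √(Q.rnDeriv (P + Q) x).toReal) ^ 2 ∂(P + Q))

/-- `s ↦ P s`, `s ∈ [0, 1]`, is a path of distributions starting at `P₀`: it is dominated by a
σ-finite measure and `H(P s, P₀) → 0` as `s → 0+`. -/
structure IsPath (P₀ : Measure 𝓧) (P : ℝ → Measure 𝓧) : Prop where
  isProbabilityMeasure : ∀ s ∈ Set.Icc (0 : ℝ) 1, IsProbabilityMeasure (P s)
  start : P 0 = P₀
  dominated : ∃ ν : Measure 𝓧, SigmaFinite ν ∧ ∀ s ∈ Set.Icc (0 : ℝ) 1, P s ≪ ν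
  tendsto_hellingerDist : Tendsto (fun s => hellingerDist (P s) P₀) (𝓝[>] 0) (𝓝 0)

/-- `P` is a path starting at `P₀`, and the Pitman efficiency of the test `T` with respect to the
test `V` for this path, at `α` and `β`, exists and equals `e ∈ [0, ∞]`. -/
def HasPitmanEfficiency (P₀ : Measure 𝓧) (P : ℝ → Measure 𝓧) (T V : (n : ℕ) → (Fin n → 𝓧) → ℝ)
    (α β : ℝ) (e : ℝ≥0∞) : Prop :=
  IsPath P₀ P ∧ Tendsto (fun s => relativeEfficiency P₀ T V α β (P s)) (𝓝[>] 0) (𝓝 e)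

/-- The contaminated beta distribution `(1 - ε) P₁₁ + ε P_pq`, for `ε ∈ [0, 1]`. -/
def contaminatedBeta (p q ε : ℝ) : Measure ℝ :=
  ENNReal.ofReal (1 - ε) • betaMeasure 1 1 + ENNReal.ofReal ε • betaMeasure p q

/-- `τ(p, q)`. -/
def tau (p q : ℝ) : ℝ := 2 * p ^ 2 - 2 * p * q - q ^ 2 + 2 * p - q

/-- `T_n = (∑ (X_i² - 1/3)) / √n`. -/
def statT (n : ℕ) (x : Fin n → ℝ) : ℝ := (∑ i, (x i ^ 2 - 1 / 3)) / √(n : ℝ)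

/-- `V_n = √n (X̄ - 1/2)`. -/
def statV (n : ℕ) (x : Fin n → ℝ) : ℝ := √(n : ℝ) * ((∑ i, x i) / (n : ℝ) - 1 / 2)

end

end Pitman

/-! Let `f` be centred under `P₀` with variance `σ²` there and mean `μ > 0` under `P₁`, and consider
the sum of the `f(X_i)` divided by `√n`, under the mixture with weight `s`. If `s √n → d`, its law
converges to a normal law with mean `d μ` and variance `σ²`. With `d = 0` this shows that the
critical value tends to `σ zα`. So the power exceeds `β = normalTail zβ` asymptotically when `d μ >
σ (zα - zβ)` and stays below it when `d μ < σ (zα - zβ)`. Hence `s² N → (σ (zα - zβ) / μ)²`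
(`tendsto_mul_minSampleSize`).

The sample size `N` requires power for every `n ≥ N`, including the range where `s √n` is unbounded
and the normal limit says nothing. There Chebyshev's inequality bounds the power from below
(`exists_bound_of_power_lt`), and compactness handles bounded `s √n` (`eventually_forall_le_power`).

In the ratio for two statistics, `s²` and `zα - zβ` cancel, leaving the ratio of the squared slopes
`(μ / σ)²`. The constants are beta moments. The path property holds because the squared Hellinger
distance is at most the L¹ distance of densities, which is at most `2 s`. -/

namespace Pitman

/-! ### Expansions of characteristic functions at zero. -/

section Asymptotics

/-- `(1 + g k) ^ n k → exp z` along sequences with `n k → ∞` and `n k * g k → z`. -/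
lemma tendsto_one_add_pow_exp {n : ℕ → ℕ} {g : ℕ → ℂ} {z : ℂ} (hn : Tendsto n atTop atTop)
    (hg : Tendsto (fun k => (n k : ℂ) * g k) atTop (𝓝 z)) :
    Tendsto (fun k => (1 + g k) ^ n k) atTop (𝓝 (Complex.exp z)) := by
  have hinv : Tendsto (fun k => ((n k : ℂ))⁻¹) atTop (𝓝 0) :=
    (tendsto_inv_atTop_nhds_zero_nat (𝕜 := ℂ)).comp hn
  have hg0 : Tendsto g atTop (𝓝 0) := by
    have := hinv.mul hg
    rw [zero_mul] at this
    refine this.congr' ?_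
    filter_upwards [hn.eventually_ne_atTop 0] with k hk
    have : (n k : ℂ) ≠ 0 := by exact_mod_cast hk
    field_simp
  -- Since `log (1 + w) = w + o(w)` and `n k * g k` is bounded, the error is still `o(1)` after
  -- multiplication by `n k`.
  have hlog : Tendsto (fun k => (n k : ℂ) * Complex.log (1 + g k)) atTop (𝓝 z) := by
    have hd : HasDerivAt (fun w : ℂ => Complex.log (1 + w)) 1 0 := by
      have := ((hasDerivAt_id (0 : ℂ)).const_add 1).clog (by simp)
      simpa using this
    have ho := (hasDerivAt_iff_isLittleO.1 hd).comp_tendsto hg0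
    have ho' : (fun k => (n k : ℂ) * (Complex.log (1 + g k) - g k))
        =o[atTop] fun k => (n k : ℂ) * g k := by
      refine (Asymptotics.isBigO_refl (fun k => (n k : ℂ)) atTop).mul_isLittleO ?_
      simpa [Function.comp_def] using ho
    have h0 := ho'.trans_isBigO (hg.isBigO_one ℂ)
    rw [Asymptotics.isLittleO_one_iff] at h0
    have h1 := h0.add hg
    rw [zero_add] at h1
    exact h1.congr fun k => by ring
  have hexp := (Complex.continuous_exp.tendsto z).comp hlog
  refine hexp.congr' ?_
  have hne : ∀ᶠ k in atTop, 1 + g k ≠ 0 := by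
    have : Tendsto (fun k => 1 + g k) atTop (𝓝 (1 + 0)) := hg0.const_add 1
    exact this.eventually_ne (by simp)
  filter_upwards [hne] with k hk
  simp [Complex.exp_nat_mul, Complex.exp_log hk]

variable {Ω : Type*} [MeasurableSpace Ω] {P : Measure Ω} [IsProbabilityMeasure P] {X : Ω → ℝ}

/-- A finite second moment makes the characteristic function C², so Taylor's formula with Peano
remainder applies. -/
lemma charFun_map_taylor_two (hX : MemLp X 2 P) :
    (fun t : ℝ => charFun (P.map X) t -
      (1 + ((∫ ω, X ω ∂P : ℝ) : ℂ) * t * Complex.I - ((∫ ω, X ω ^ 2 ∂P : ℝ) : ℂ) * t ^ 2 / 2))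
      =o[𝓝 0] fun t : ℝ => t ^ 2 := by
  have hXm : AEMeasurable X P := hX.aestronglyMeasurable.aemeasurable
  have : IsProbabilityMeasure (P.map X) := Measure.isProbabilityMeasure_map hXm
  have hid : MemLp id 2 (P.map X) := (memLp_map_measure_iff (by fun_prop) hXm).2 (by simpa using hX)
  have key := fun t => taylorWithinEval_charFun_two_zero hXm hid t
  simp only [Pi.pow_apply] at key
  simp_rw [← key]
  convert! taylor_isLittleO_univ (n := 2) (f := charFun (P.map X)) (x₀ := 0) ?_
  · simp
  · exact contDiff_charFun hid

lemma tendsto_inv_sqrt_mul {n : ℕ → ℕ} (hn : Tendsto n atTop atTop) (t : ℝ) :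
    Tendsto (fun k => (√(n k : ℝ))⁻¹ * t) atTop (𝓝 0) := by
  rw [← zero_mul t]
  exact .mul_const t (tendsto_inv_atTop_zero.comp <| Real.tendsto_sqrt_atTop.comp <|
    tendsto_natCast_atTop_atTop.comp hn)

/-- Centring removes the term of order `√n`, so only the quadratic term survives. This is the
contribution of `P₀`. -/
lemma tendsto_mul_charFun_sub_one_of_centered {n : ℕ → ℕ} (hn : Tendsto n atTop atTop)
    (hX : MemLp X 2 P) (h0 : ∫ ω, X ω ∂P = 0) (t : ℝ) :
    Tendsto (fun k => (n k : ℂ) * (charFun (P.map X) ((√(n k : ℝ))⁻¹ * t) - 1)) atTop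
      (𝓝 (-(((∫ ω, X ω ^ 2 ∂P : ℝ) : ℂ) * t ^ 2 / 2))) := by
  have ho := (charFun_map_taylor_two hX).comp_tendsto (tendsto_inv_sqrt_mul hn t)
  have hb : (fun k => (((√(n k : ℝ))⁻¹ * t) ^ 2 : ℝ)) =O[atTop] fun k => ((n k : ℂ))⁻¹ := by
    refine Asymptotics.IsBigO.of_bound (t ^ 2) (.of_forall fun k => le_of_eq ?_)
    simp [mul_pow, mul_comm]
  have h := (Asymptotics.isBigO_refl (fun k => (n k : ℂ)) atTop).mul_isLittleO (ho.trans_isBigO hb)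
  have h1 : Tendsto (fun k => (n k : ℂ) * ((n k : ℂ))⁻¹) atTop (𝓝 1) :=
    tendsto_const_nhds.congr' (by
      filter_upwards [hn.eventually_ne_atTop 0] with k hk
      rw [mul_inv_cancel₀]; exact_mod_cast hk)
  have h2 := h.trans_isBigO (h1.isBigO_one ℂ)
  rw [Asymptotics.isLittleO_one_iff] at h2
  have h3 := h2.add_const (-(((∫ ω, X ω ^ 2 ∂P : ℝ) : ℂ) * t ^ 2 / 2))
  rw [zero_add] at h3
  refine h3.congr' ?_
  filter_upwards [hn.eventually_ne_atTop 0] with k hk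
  have hk' : (n k : ℂ) ≠ 0 := by exact_mod_cast hk
  have hs : ((√(n k : ℝ) : ℝ) : ℂ) ^ 2 = n k := by
    rw [← Complex.ofReal_pow, Real.sq_sqrt (by positivity)]; simp
  simp only [Function.comp, h0]
  push_cast
  rw [mul_pow, inv_pow, hs]
  field_simp
  ring

/-- The contribution of `P₁`: its weight `s` is of order `1/√n`, so the relevant factor is `√n`
rather than `n`, and only the mean is visible. -/
lemma tendsto_sqrt_mul_charFun_sub_one {n : ℕ → ℕ} (hn : Tendsto n atTop atTop)
    (hX : MemLp X 2 P) (t : ℝ) :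
    Tendsto (fun k => ((√(n k : ℝ) : ℝ) : ℂ) * (charFun (P.map X) ((√(n k : ℝ))⁻¹ * t) - 1)) atTop
      (𝓝 (((∫ ω, X ω ∂P : ℝ) : ℂ) * t * Complex.I)) := by
  set m := ∫ ω, X ω ∂P with hm
  set v := ∫ ω, X ω ^ 2 ∂P with hv
  have hu := tendsto_inv_sqrt_mul hn t
  have ho : (fun u : ℝ => charFun (P.map X) u - (1 + (m : ℂ) * u * Complex.I))
      =o[𝓝 0] fun u : ℝ => u := by
    have h1 := (charFun_map_taylor_two hX).trans (Asymptotics.isLittleO_pow_id one_lt_two)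
    have h2 : (fun u : ℝ => -((v : ℂ) * u ^ 2 / 2)) =o[𝓝 0] fun u : ℝ => u := by
      have : (fun u : ℝ => -((v : ℂ) * u ^ 2 / 2)) =O[𝓝 0] fun u : ℝ => u ^ 2 := by
        refine Asymptotics.IsBigO.of_bound (|v| / 2) (.of_forall fun u => le_of_eq ?_)
        simp; ring
      exact this.trans_isLittleO (Asymptotics.isLittleO_pow_id one_lt_two)
    refine (h1.add h2).congr (fun u => ?_) (fun u => rfl)
    rw [← hm, ← hv]; ring
  have ho := ho.comp_tendsto hu
  have hb : (fun k => (((√(n k : ℝ))⁻¹ * t) : ℝ)) =O[atTop]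
      fun k => (((√(n k : ℝ) : ℝ) : ℂ))⁻¹ := by
    refine Asymptotics.IsBigO.of_bound (|t|) (.of_forall fun k => le_of_eq ?_)
    simp [mul_comm]
  have h := (Asymptotics.isBigO_refl (fun k => ((√(n k : ℝ) : ℝ) : ℂ)) atTop).mul_isLittleO
    (ho.trans_isBigO hb)
  have hne : ∀ᶠ k in atTop, ((√(n k : ℝ) : ℝ) : ℂ) ≠ 0 := by
    filter_upwards [hn.eventually_gt_atTop 0] with k hk
    have : √(n k : ℝ) ≠ 0 := (Real.sqrt_pos.2 (by exact_mod_cast hk)).ne'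
    exact_mod_cast this
  have h1 : Tendsto (fun k => ((√(n k : ℝ) : ℝ) : ℂ) * (((√(n k : ℝ) : ℝ) : ℂ))⁻¹) atTop (𝓝 1) :=
    tendsto_const_nhds.congr' (by
      filter_upwards [hne] with k hk
      rw [mul_inv_cancel₀ hk])
  have h2 := h.trans_isBigO (h1.isBigO_one ℂ)
  rw [Asymptotics.isLittleO_one_iff] at h2
  have h3 := h2.add_const ((m : ℂ) * t * Complex.I)
  rw [zero_add] at h3
  refine h3.congr' ?_
  filter_upwards [hne] with k hk
  simp only [Function.comp]
  push_cast
  field_simp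
  ring

end Asymptotics

end Pitman

namespace Pitman

noncomputable section

/-! ### The normal tail function and its quantiles. -/

section GaussianTail

/-- Upper tail probability of the standard normal distribution. -/
def normalTail (x : ℝ) : ℝ := (gaussianReal 0 1).real (Set.Ioi x)

lemma normalTail_eq_one_sub_cdf (x : ℝ) : normalTail x = 1 - cdf (gaussianReal 0 1) x := by
  rw [cdf_eq_real, normalTail, ← Set.compl_Iic, probReal_compl_eq_one_sub measurableSet_Iic]

lemma continuous_normalTail : Continuous normalTail := by
  have h : Continuous (cdf (gaussianReal 0 1)) := by
    refine continuous_iff_continuousAt.2 fun x => ?_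
    rw [(monotone_cdf _).continuousAt_iff_leftLim_eq_rightLim, StieltjesFunction.rightLim_eq]
    have h1 := StieltjesFunction.measure_singleton (cdf (gaussianReal 0 1)) x
    have : NullSingletonClass (gaussianReal 0 1) := nullSingletonClass_gaussianReal one_ne_zero
    rw [measure_cdf, measure_singleton, eq_comm, ENNReal.ofReal_eq_zero] at h1
    exact le_antisymm ((monotone_cdf _).leftLim_le le_rfl) (by linarith)
  exact (continuous_const.sub h).congr fun x => (normalTail_eq_one_sub_cdf x).symm

lemma strictAnti_normalTail : StrictAnti normalTail := by
  intro x y hxy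
  have hd : Disjoint (Set.Ioc x y) (Set.Ioi y) := by
    rw [Set.disjoint_left]; intro a ha hb; exact absurd ha.2 (not_le.2 hb)
  have hu := measureReal_union (μ := gaussianReal 0 1) hd measurableSet_Ioi
  rw [Set.Ioc_union_Ioi_eq_Ioi hxy.le] at hu
  have hpos : 0 < (gaussianReal 0 1).real (Set.Ioc x y) := by
    refine ENNReal.toReal_pos (fun h0 => ?_) (measure_ne_top _ _)
    have := gaussianReal_absolutelyContinuous' 0 one_ne_zero h0
    simp [hxy.not_ge] at this
  unfold normalTail
  linarith

lemma exists_normalTail_eq {a : ℝ} (h0 : 0 < a) (h1 : a < 1) : ∃ z, normalTail z = a := by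
  refine mem_range_of_exists_le_of_exists_ge continuous_normalTail ?_ ?_
  · obtain ⟨x, hx⟩ := ((tendsto_cdf_atTop (gaussianReal 0 1)).eventually_const_le
      (show 1 - a < 1 by linarith)).exists
    exact ⟨x, by rw [normalTail_eq_one_sub_cdf]; linarith⟩
  · obtain ⟨x, hx⟩ := ((tendsto_cdf_atBot (gaussianReal 0 1)).eventually_le_const
      (show 0 < 1 - a by linarith)).exists
    exact ⟨x, by rw [normalTail_eq_one_sub_cdf]; linarith⟩

lemma gaussianReal_real_Ioi (m t : ℝ) {σ : ℝ} (hσ : 0 < σ) :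
    (gaussianReal m (σ ^ 2).toNNReal).real (Set.Ioi t) = normalTail ((t - m) / σ) := by
  have h : gaussianReal m (σ ^ 2).toNNReal = (gaussianReal 0 1).map (fun x => σ * x + m) := by
    have h1 := gaussianReal_map_const_mul (μ := 0) (v := 1) σ
    have h2 := gaussianReal_map_add_const (μ := σ * 0) (v := .mk (σ ^ 2) (sq_nonneg _) * 1) m
    rw [← h1, Measure.map_map (by fun_prop) (by fun_prop)] at h2
    rw [Function.comp_def] at h2
    rw [h2]
    congr 1
    · simp
    · ext; simp [Real.coe_toNNReal _ (sq_nonneg σ)]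
  rw [h, map_measureReal_apply (by fun_prop) measurableSet_Ioi, normalTail]
  congr 1
  ext x
  simp only [Set.mem_preimage, Set.mem_Ioi, div_lt_iff₀ hσ]
  constructor <;> intro h <;> linarith

end GaussianTail

/-! ### Central limit theorem along contiguous linear contaminations. -/

section Mixture

variable {𝓧 : Type*} [MeasurableSpace 𝓧]

/-- The linear contamination `(1 - s) P₀ + s P₁`. -/
def mixture (P₀ P₁ : Measure 𝓧) (s : ℝ) : Measure 𝓧 :=
  ENNReal.ofReal (1 - s) • P₀ + ENNReal.ofReal s • P₁

/-- `(∑ f(X_i)) / √n`. -/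
def normalizedSum (f : 𝓧 → ℝ) (n : ℕ) (x : Fin n → 𝓧) : ℝ := (∑ i, f (x i)) / √(n : ℝ)

variable {P₀ P₁ : Measure 𝓧} {f : 𝓧 → ℝ}

lemma mixture_zero : mixture P₀ P₁ 0 = P₀ := by simp [mixture]

lemma integral_mixture {E : Type*} [NormedAddCommGroup E] [NormedSpace ℝ E] {g : 𝓧 → E} {s : ℝ}
    (hs : s ∈ Set.Icc (0 : ℝ) 1) (h₀ : Integrable g P₀) (h₁ : Integrable g P₁) :
    ∫ x, g x ∂mixture P₀ P₁ s = (1 - s) • ∫ x, g x ∂P₀ + s • ∫ x, g x ∂P₁ := by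
  rw [mixture, integral_add_measure (h₀.smul_measure ENNReal.ofReal_ne_top)
    (h₁.smul_measure ENNReal.ofReal_ne_top), integral_smul_measure, integral_smul_measure,
    ENNReal.toReal_ofReal (by linarith [hs.2]), ENNReal.toReal_ofReal hs.1]

lemma memLp_mixture {s : ℝ} (h₀ : MemLp f 2 P₀) (h₁ : MemLp f 2 P₁) :
    MemLp f 2 (mixture P₀ P₁ s) := by
  have h₀' := h₀.smul_measure (ENNReal.ofReal_ne_top (r := 1 - s))
  have h₁' := h₁.smul_measure (ENNReal.ofReal_ne_top (r := s))
  have hm := h₀'.aestronglyMeasurable.add_measure h₁'.aestronglyMeasurable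
  exact (memLp_two_iff_integrable_sq hm).2 (h₀'.integrable_sq.add_measure h₁'.integrable_sq)

variable [IsProbabilityMeasure P₀] [IsProbabilityMeasure P₁]

lemma isProbabilityMeasure_mixture {s : ℝ} (hs : s ∈ Set.Icc (0 : ℝ) 1) :
    IsProbabilityMeasure (mixture P₀ P₁ s) where
  measure_univ := by
    simp only [mixture, Measure.add_apply, Measure.smul_apply, measure_univ, smul_eq_mul, mul_one]
    rw [← ENNReal.ofReal_add (by linarith [hs.2]) hs.1]
    simp

lemma charFun_map_mixture (hf : Measurable f) {s : ℝ} (hs : s ∈ Set.Icc (0 : ℝ) 1) (t : ℝ) :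
    charFun ((mixture P₀ P₁ s).map f) t =
      (1 - s) * charFun (P₀.map f) t + s * charFun (P₁.map f) t := by
  have hint (P : Measure 𝓧) [IsProbabilityMeasure P] :
      Integrable (fun x => Complex.exp (t * f x * Complex.I)) P := by
    refine Integrable.of_bound (by fun_prop) 1 (.of_forall fun x => le_of_eq ?_)
    rw [← Complex.ofReal_mul, Complex.norm_exp_ofReal_mul_I]
  simp only [charFun_apply_real]
  rw [integral_map (by fun_prop) (by fun_prop), integral_map (by fun_prop) (by fun_prop),
    integral_map (by fun_prop) (by fun_prop), integral_mixture hs (hint P₀) (hint P₁)]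
  simp

@[fun_prop]
lemma measurable_normalizedSum (hf : Measurable f) (n : ℕ) : Measurable (normalizedSum f n) := by
  unfold normalizedSum
  fun_prop

lemma charFun_map_normalizedSum (hf : Measurable f) (n : ℕ) (t : ℝ) :
    charFun ((sampleLaw P₀ n).map (normalizedSum f n)) t =
      (charFun (P₀.map f) ((√(n : ℝ))⁻¹ * t)) ^ n := by
  rw [charFun_apply_real, integral_map (by fun_prop) (by fun_prop), charFun_apply_real,
    integral_map (by fun_prop) (by fun_prop), sampleLaw]
  have := integral_fintype_prod_eq_pow (ι := Fin n) (μ := P₀)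
    (fun x => Complex.exp (((√(n : ℝ))⁻¹ * t : ℝ) * f x * Complex.I))
  rw [Fintype.card_fin] at this
  rw [← this]
  congr with x
  rw [← Complex.exp_sum, normalizedSum]
  push_cast
  rw [Finset.sum_div, Finset.mul_sum, Finset.sum_mul]
  congr 1
  refine Finset.sum_congr rfl fun i _ => ?_
  ring

instance (n : ℕ) : IsProbabilityMeasure (sampleLaw P₀ n) := by
  unfold sampleLaw; infer_instance

/-- With `φ₀`, `φ₁` the characteristic functions of `f` under `P₀`, `P₁`, split `n ((1-s) φ₀ + s φ₁
- 1)` as `(1-s) · n (φ₀ - 1) + (s √n) · √n (φ₁ - 1)`: the first part gives the variance, the second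
the drift. -/
lemma tendsto_charFun_normalizedSum_mixture (hf : Measurable f) (h₀ : MemLp f 2 P₀)
    (h₁ : MemLp f 2 P₁) (hm : ∫ x, f x ∂P₀ = 0) {n : ℕ → ℕ} {s : ℕ → ℝ} {d : ℝ}
    (hn : Tendsto n atTop atTop) (hs : ∀ k, s k ∈ Set.Icc (0 : ℝ) 1) (hs0 : Tendsto s atTop (𝓝 0))
    (hd : Tendsto (fun k => s k * √(n k : ℝ)) atTop (𝓝 d)) (t : ℝ) :
    Tendsto (fun k => charFun ((sampleLaw (mixture P₀ P₁ (s k)) (n k)).map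
        (normalizedSum f (n k))) t) atTop
      (𝓝 (Complex.exp (t * (d * ∫ x, f x ∂P₁ : ℝ) * Complex.I
        - (∫ x, f x ^ 2 ∂P₀ : ℝ) * t ^ 2 / 2))) := by
  have hprob := fun k => isProbabilityMeasure_mixture (P₀ := P₀) (P₁ := P₁) (hs k)
  simp_rw [charFun_map_normalizedSum hf,
    fun k => charFun_map_mixture (P₀ := P₀) (P₁ := P₁) hf (hs k)]
  have h := tendsto_one_add_pow_exp (g := fun k =>
    ((1 - s k) * charFun (P₀.map f) ((√(n k : ℝ))⁻¹ * t) +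
      s k * charFun (P₁.map f) ((√(n k : ℝ))⁻¹ * t)) - 1)
    (z := t * (d * ∫ x, f x ∂P₁ : ℝ) * Complex.I - (∫ x, f x ^ 2 ∂P₀ : ℝ) * t ^ 2 / 2) hn ?_
  · simpa using h
  · have hsC : Tendsto (fun k => (1 - (s k : ℂ))) atTop (𝓝 1) := by
      simpa using ((Complex.continuous_ofReal.tendsto 0).comp hs0).const_sub 1
    have hdC := (Complex.continuous_ofReal.tendsto d).comp hd
    have h := (hsC.mul (tendsto_mul_charFun_sub_one_of_centered hn h₀ hm t)).add
      (hdC.mul (tendsto_sqrt_mul_charFun_sub_one hn h₁ t))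
    have e : 1 * -(((∫ ω, f ω ^ 2 ∂P₀ : ℝ) : ℂ) * t ^ 2 / 2)
        + d * ((∫ x, f x ∂P₁ : ℝ) * t * Complex.I)
        = t * (d * ∫ x, f x ∂P₁ : ℝ) * Complex.I - (∫ x, f x ^ 2 ∂P₀ : ℝ) * t ^ 2 / 2 := by
      push_cast; ring
    rw [e] at h
    refine h.congr fun k => ?_
    have hsq : ((√(n k : ℝ) : ℝ) : ℂ) * ((√(n k : ℝ) : ℝ) : ℂ) = n k := by
      rw [← Complex.ofReal_mul, Real.mul_self_sqrt (by positivity)]; simp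
    rw [← hsq]
    simp only [Function.comp]
    push_cast
    ring

/-- Lévy's continuity theorem gives weak convergence; the limit has no atoms, so half-lines are
continuity sets. -/
lemma tendsto_tail_normalizedSum_mixture (hf : Measurable f) (h₀ : MemLp f 2 P₀)
    (h₁ : MemLp f 2 P₁) (hm : ∫ x, f x ∂P₀ = 0) {σ : ℝ} (hσ : 0 < σ)
    (hv : ∫ x, f x ^ 2 ∂P₀ = σ ^ 2) {n : ℕ → ℕ} {s : ℕ → ℝ} {d : ℝ}
    (hn : Tendsto n atTop atTop) (hs : ∀ k, s k ∈ Set.Icc (0 : ℝ) 1) (hs0 : Tendsto s atTop (𝓝 0))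
    (hd : Tendsto (fun k => s k * √(n k : ℝ)) atTop (𝓝 d)) (t : ℝ) :
    Tendsto (fun k => (sampleLaw (mixture P₀ P₁ (s k)) (n k)).real
        {x | t < normalizedSum f (n k) x}) atTop
      (𝓝 (normalTail ((t - d * ∫ x, f x ∂P₁) / σ))) := by
  have hprob := fun k => isProbabilityMeasure_mixture (P₀ := P₀) (P₁ := P₁) (hs k)
  have hv0 : (σ ^ 2).toNNReal ≠ 0 := by simp; positivity
  let law : ℕ → ProbabilityMeasure ℝ := fun k =>
    ⟨(sampleLaw (mixture P₀ P₁ (s k)) (n k)).map (normalizedSum f (n k)),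
      Measure.isProbabilityMeasure_map (by fun_prop)⟩
  let lim : ProbabilityMeasure ℝ :=
    ⟨gaussianReal (d * ∫ x, f x ∂P₁) (σ ^ 2).toNNReal, inferInstance⟩
  have hlaw : Tendsto law atTop (𝓝 lim) := by
    refine ProbabilityMeasure.tendsto_of_tendsto_charFun fun t => ?_
    have := tendsto_charFun_normalizedSum_mixture hf h₀ h₁ hm hn hs hs0 hd t
    simp only [law, lim, ProbabilityMeasure.coe_mk, charFun_gaussianReal]
    rw [hv] at this
    simpa [Real.coe_toNNReal _ (sq_nonneg σ)] using this
  have : NullSingletonClass (gaussianReal (d * ∫ x, f x ∂P₁) (σ ^ 2).toNNReal) :=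
    nullSingletonClass_gaussianReal hv0
  have h := ProbabilityMeasure.tendsto_measure_of_null_frontier_of_tendsto' hlaw (E := Set.Ioi t)
    (by simp [lim])
  have h2 := (ENNReal.tendsto_toReal (measure_ne_top _ _)).comp h
  have h3 : (lim : Measure ℝ).real (Set.Ioi t) = normalTail ((t - d * ∫ x, f x ∂P₁) / σ) :=
    gaussianReal_real_Ioi _ _ hσ
  rw [← h3]
  refine h2.congr fun k => ?_
  simp only [law, Function.comp, ProbabilityMeasure.coe_mk]
  rw [Measure.map_apply (by fun_prop) measurableSet_Ioi]
  rfl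

end Mixture

end

end Pitman

namespace Pitman

noncomputable section

variable {𝓧 : Type*} [MeasurableSpace 𝓧]

/-! ### Convergence of the exact critical values. -/

section CriticalValue

variable {P₀ : Measure 𝓧} [IsProbabilityMeasure P₀] {f : 𝓧 → ℝ}

lemma criticalValue_mem_Icc {W : (n : ℕ) → (Fin n → 𝓧) → ℝ} {α : ℝ} {n : ℕ} {t t' : ℝ}
    (ht : α < (sampleLaw P₀ n).real {x | t < W n x})
    (ht' : (sampleLaw P₀ n).real {x | t' < W n x} ≤ α) :
    criticalValue P₀ W α n ∈ Set.Icc t t' := by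
  have hlow : ∀ u ∈ {u : ℝ | (sampleLaw P₀ n).real {x | u < W n x} ≤ α}, t ≤ u := by
    intro u hu
    by_contra! h
    exact absurd (ht.trans_le (measureReal_mono fun x hx => lt_trans h hx)) (not_lt.2 hu)
  exact ⟨le_csInf ⟨t', ht'⟩ hlow, csInf_le ⟨t, hlow⟩ ht'⟩

lemma eventually_criticalValue_mem_Icc (hf : Measurable f) (h₀ : MemLp f 2 P₀)
    (hm : ∫ x, f x ∂P₀ = 0) {σ : ℝ} (hσ : 0 < σ) (hv : ∫ x, f x ^ 2 ∂P₀ = σ ^ 2) {z t t' : ℝ}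
    (ht : t < σ * z) (ht' : σ * z < t') :
    ∀ᶠ n in atTop, criticalValue P₀ (normalizedSum f) (normalTail z) n ∈ Set.Icc t t' := by
  have key (u : ℝ) : Tendsto (fun n => (sampleLaw P₀ n).real {x | u < normalizedSum f n x}) atTop
      (𝓝 (normalTail (u / σ))) := by
    -- The null case is the degenerate path `s = 0`, `d = 0`.
    have := tendsto_tail_normalizedSum_mixture (P₁ := P₀) hf h₀ h₀ hm hσ hv (n := id)
      (s := fun _ => 0) (d := 0) tendsto_id (by simp) tendsto_const_nhds (by simp) u
    simpa [mixture_zero] using this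
  have h1 := (key t).eventually_const_lt (strictAnti_normalTail
    (show t / σ < z by rw [div_lt_iff₀ hσ]; linarith))
  have h2 := (key t').eventually_lt_const (strictAnti_normalTail
    (show z < t' / σ by rw [lt_div_iff₀ hσ]; linarith))
  filter_upwards [h1, h2] with n h1 h2
  exact criticalValue_mem_Icc h1 h2.le

end CriticalValue

/-! ### Chebyshev lower bound for the tail, valid for every sample size. -/

section Chebyshev

variable {P : Measure 𝓧} [IsProbabilityMeasure P] {f : 𝓧 → ℝ}

lemma integral_normalizedSum (hf : MemLp f 2 P) (n : ℕ) :
    ∫ x, normalizedSum f n x ∂sampleLaw P n = √(n : ℝ) * ∫ x, f x ∂P := by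
  have hint : Integrable f P := hf.integrable one_le_two
  simp only [normalizedSum, sampleLaw]
  rw [integral_div, integral_finsetSum _ fun i _ => integrable_comp_eval hint]
  simp_rw [integral_comp_eval (μ := fun _ : Fin n => P) hf.aestronglyMeasurable]
  simp only [Finset.sum_const, Finset.card_univ, Fintype.card_fin, nsmul_eq_mul]
  rw [mul_div_right_comm, Real.div_sqrt]

lemma memLp_normalizedSum (hf : MemLp f 2 P) (n : ℕ) :
    MemLp (normalizedSum f n) 2 (sampleLaw P n) := by
  have h : MemLp (fun x : Fin n → 𝓧 => ∑ i, f (x i)) 2 (sampleLaw P n) :=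
    memLp_finsetSum _ fun i _ => hf.comp_measurePreserving (measurePreserving_eval _ i)
  refine (h.const_smul (√(n : ℝ))⁻¹).congr_norm ?_ (.of_forall fun x => ?_)
  · exact (h.aestronglyMeasurable.const_smul (√(n : ℝ))⁻¹).congr
      (.of_forall fun x => by simp [normalizedSum, div_eq_inv_mul])
  · simp [normalizedSum, div_eq_inv_mul]

lemma variance_normalizedSum_le (hf : MemLp f 2 P) (n : ℕ) :
    Var[normalizedSum f n; sampleLaw P n] ≤ ∫ x, f x ^ 2 ∂P := by
  have h : normalizedSum f n
      = fun x => (√(n : ℝ))⁻¹ * (∑ i, fun ω : Fin n → 𝓧 => f (ω i)) x := by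
    ext x; simp [normalizedSum, div_eq_inv_mul]
  have hV : Var[f; P] ≤ ∫ x, f x ^ 2 ∂P := variance_le_expectation_sq hf.aestronglyMeasurable
  rw [h, variance_const_mul, sampleLaw, variance_sum_pi fun _ => hf]
  simp only [Finset.sum_const, Finset.card_univ, Fintype.card_fin, nsmul_eq_mul, inv_pow,
    Real.sq_sqrt (Nat.cast_nonneg n), ← mul_assoc]
  have h0 := variance_nonneg f P
  -- For `n = 0` the inverse is `0` by convention and the bound reduces to nonnegativity.
  rcases eq_or_ne (n : ℝ) 0 with hn | hn
  · simp only [hn]; simpa using h0.trans hV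
  · rwa [inv_mul_cancel₀ hn, one_mul]

lemma one_sub_le_tail_normalizedSum (hfm : Measurable f) (hf : MemLp f 2 P) {n : ℕ} {t : ℝ}
    (ht : t < √(n : ℝ) * ∫ x, f x ∂P) :
    1 - (∫ x, f x ^ 2 ∂P) / (√(n : ℝ) * ∫ x, f x ∂P - t) ^ 2 ≤
      (sampleLaw P n).real {x | t < normalizedSum f n x} := by
  set c := √(n : ℝ) * ∫ x, f x ∂P - t with hc
  have hc0 : 0 < c := by linarith
  have hms : MeasurableSet {x | t < normalizedSum f n x} :=
    measurableSet_lt measurable_const (by fun_prop)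
  have hcheb := meas_ge_le_variance_div_sq (memLp_normalizedSum hf n) hc0
  have hcheb' : (sampleLaw P n).real {x | t < normalizedSum f n x}ᶜ ≤
      Var[normalizedSum f n; sampleLaw P n] / c ^ 2 := by
    refine ENNReal.toReal_le_of_le_ofReal (div_nonneg (variance_nonneg _ _) (sq_nonneg c))
      (le_trans (measure_mono ?_) hcheb)
    intro x hx
    simp only [Set.mem_compl_iff, Set.mem_ofPred_eq, not_lt] at hx ⊢
    rw [integral_normalizedSum hf, abs_sub_comm]
    exact le_trans (by linarith) (le_abs_self _)
  rw [probReal_compl_eq_one_sub hms] at hcheb'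
  have := div_le_div_of_nonneg_right (variance_normalizedSum_le hf n) (sq_nonneg c)
  linarith

end Chebyshev

/-! ### Asymptotics of the minimal sample size. -/

section SampleSize

variable {P₀ P₁ : Measure 𝓧} {f : 𝓧 → ℝ} {σ zα zβ : ℝ}

lemma minSampleSize_le {W : (n : ℕ) → (Fin n → 𝓧) → ℝ} {α β : ℝ} {P : Measure 𝓧} {N : ℕ}
    (hN : 1 ≤ N) (h : ∀ n, N ≤ n → β ≤ power P₀ W α P n) :
    minSampleSize P₀ W α β P ≤ N :=
  iInf₂_le N ⟨hN, h⟩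

/-- One failure at `n` excludes every `N ≤ n`, since `N` must work for all larger sizes; hence the
gain of one. -/
lemma le_minSampleSize {W : (n : ℕ) → (Fin n → 𝓧) → ℝ} {α β : ℝ} {P : Measure 𝓧} {n : ℕ}
    (h : power P₀ W α P n < β) : ((n + 1 : ℕ) : ℝ≥0∞) ≤ minSampleSize P₀ W α β P := by
  refine le_iInf₂ fun N hN => ?_
  rw [Nat.cast_le]
  by_contra! hlt
  exact absurd h (not_lt.2 (hN.2 n (by omega)))

variable [IsProbabilityMeasure P₀] [IsProbabilityMeasure P₁]

lemma eventually_power_lt (hf : Measurable f) (h₀ : MemLp f 2 P₀)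
    (h₁ : MemLp f 2 P₁) (hm : ∫ x, f x ∂P₀ = 0) (hσ : 0 < σ)
    (hv : ∫ x, f x ^ 2 ∂P₀ = σ ^ 2) {n : ℕ → ℕ} {s : ℕ → ℝ} {d : ℝ}
    (hn : Tendsto n atTop atTop) (hs : ∀ k, s k ∈ Set.Icc (0 : ℝ) 1) (hs0 : Tendsto s atTop (𝓝 0))
    (hd : Tendsto (fun k => s k * √(n k : ℝ)) atTop (𝓝 d))
    (hlt : d * ∫ x, f x ∂P₁ < σ * (zα - zβ)) :
    ∀ᶠ k in atTop, power P₀ (normalizedSum f) (normalTail zα) (mixture P₀ P₁ (s k)) (n k)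
      < normalTail zβ := by
  have hprob := fun k => isProbabilityMeasure_mixture (P₀ := P₀) (P₁ := P₁) (hs k)
  -- A fixed `t` below the limiting critical value whose limiting tail is still below `normalTail
  -- zβ`; it replaces the moving critical value.
  obtain ⟨t, ht1, ht2⟩ := exists_between (show σ * zβ + d * ∫ x, f x ∂P₁ < σ * zα by linarith)
  have hcrit := hn.eventually
    (eventually_criticalValue_mem_Icc hf h₀ hm hσ hv ht2 (lt_add_one (σ * zα)))
  have htail := (tendsto_tail_normalizedSum_mixture hf h₀ h₁ hm hσ hv hn hs hs0 hd
    t).eventually_lt_const (strictAnti_normalTail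
      (show zβ < (t - d * ∫ x, f x ∂P₁) / σ by rw [lt_div_iff₀ hσ]; linarith))
  filter_upwards [hcrit, htail] with k hk1 hk2
  exact lt_of_le_of_lt (measureReal_mono fun x hx => lt_of_le_of_lt hk1.1 hx) hk2

lemma eventually_lt_power (hf : Measurable f) (h₀ : MemLp f 2 P₀)
    (h₁ : MemLp f 2 P₁) (hm : ∫ x, f x ∂P₀ = 0) (hσ : 0 < σ)
    (hv : ∫ x, f x ^ 2 ∂P₀ = σ ^ 2) {n : ℕ → ℕ} {s : ℕ → ℝ} {d : ℝ}
    (hn : Tendsto n atTop atTop) (hs : ∀ k, s k ∈ Set.Icc (0 : ℝ) 1) (hs0 : Tendsto s atTop (𝓝 0))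
    (hd : Tendsto (fun k => s k * √(n k : ℝ)) atTop (𝓝 d))
    (hlt : σ * (zα - zβ) < d * ∫ x, f x ∂P₁) :
    ∀ᶠ k in atTop, normalTail zβ <
      power P₀ (normalizedSum f) (normalTail zα) (mixture P₀ P₁ (s k)) (n k) := by
  have hprob := fun k => isProbabilityMeasure_mixture (P₀ := P₀) (P₁ := P₁) (hs k)
  obtain ⟨t, ht1, ht2⟩ := exists_between (show σ * zα < σ * zβ + d * ∫ x, f x ∂P₁ by linarith)
  have hcrit := hn.eventually
    (eventually_criticalValue_mem_Icc hf h₀ hm hσ hv (sub_one_lt (σ * zα)) ht1)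
  have htail := (tendsto_tail_normalizedSum_mixture hf h₀ h₁ hm hσ hv hn hs hs0 hd
    t).eventually_const_lt (strictAnti_normalTail
      (show (t - d * ∫ x, f x ∂P₁) / σ < zβ by rw [div_lt_iff₀ hσ]; linarith))
  filter_upwards [hcrit, htail] with k hk1 hk2
  exact lt_of_lt_of_le hk2 (measureReal_mono fun x hx => lt_of_le_of_lt hk1.2 hx)

/-- If the power stays below `normalTail zβ < 1`, then `s √n` stays bounded. -/
lemma exists_bound_of_power_lt (hf : Measurable f) (h₀ : MemLp f 2 P₀)
    (h₁ : MemLp f 2 P₁) (hm : ∫ x, f x ∂P₀ = 0) (hσ : 0 < σ)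
    (hv : ∫ x, f x ^ 2 ∂P₀ = σ ^ 2) (hμ : 0 < ∫ x, f x ∂P₁) {β : ℝ} (hβ : β < 1) :
    ∃ C, ∀ᶠ n in atTop, ∀ s ∈ Set.Icc (0 : ℝ) 1,
      power P₀ (normalizedSum f) (normalTail zα) (mixture P₀ P₁ s) n < β → s * √(n : ℝ) ≤ C := by
  set μ := ∫ x, f x ∂P₁
  set t := σ * zα + 1
  set v := ∫ x, f x ^ 2 ∂P₀ + ∫ x, f x ^ 2 ∂P₁ with hvdef
  -- Here `t` eventually dominates the critical value and `v` bounds the second moment under every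
  -- mixture. Beyond this constant, `√n s μ - t` exceeds `√(v / (1 - β))`, so Chebyshev forces power
  -- at least `β`.
  refine ⟨(t + √(v / (1 - β))) / μ, ?_⟩
  filter_upwards [eventually_criticalValue_mem_Icc hf h₀ hm hσ hv (sub_one_lt (σ * zα))
    (lt_add_one (σ * zα))] with n hn s hs hpow
  have hprob := isProbabilityMeasure_mixture (P₀ := P₀) (P₁ := P₁) hs
  by_contra! hC
  rw [div_lt_iff₀ hμ] at hC
  have hmean : ∫ x, f x ∂mixture P₀ P₁ s = s * μ := by
    rw [integral_mixture hs (h₀.integrable one_le_two) (h₁.integrable one_le_two), hm]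
    simp [μ]
  have hsq : ∫ x, f x ^ 2 ∂mixture P₀ P₁ s ≤ v := by
    rw [integral_mixture hs h₀.integrable_sq h₁.integrable_sq]
    have e0 : 0 ≤ ∫ x, f x ^ 2 ∂P₀ := integral_nonneg fun x => sq_nonneg _
    have e1 : 0 ≤ ∫ x, f x ^ 2 ∂P₁ := integral_nonneg fun x => sq_nonneg _
    simp only [smul_eq_mul, hvdef]
    nlinarith [hs.1, hs.2]
  have hv0 : 0 ≤ v := (integral_nonneg fun x => sq_nonneg _).trans hsq
  have hr : 0 ≤ √(v / (1 - β)) := Real.sqrt_nonneg _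
  have hch := one_sub_le_tail_normalizedSum (P := mixture P₀ P₁ s) (n := n) (t := t) hf
    (memLp_mixture h₀ h₁) (by rw [hmean]; linarith)
  rw [hmean] at hch
  have hgap : √(v / (1 - β)) < √(n : ℝ) * (s * μ) - t := by linarith
  have hgap2 : v / (1 - β) < (√(n : ℝ) * (s * μ) - t) ^ 2 := by
    rwa [Real.sqrt_lt' (hr.trans_lt hgap)] at hgap
  have hbd : (∫ x, f x ^ 2 ∂mixture P₀ P₁ s) / (√(n : ℝ) * (s * μ) - t) ^ 2 ≤ 1 - β := by
    have hpos : 0 < (√(n : ℝ) * (s * μ) - t) ^ 2 := pow_pos (hr.trans_lt hgap) 2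
    rw [div_lt_iff₀ (by linarith)] at hgap2
    rw [div_le_iff₀ hpos]
    linarith
  have hmono : (sampleLaw (mixture P₀ P₁ s) n).real {x | t < normalizedSum f n x} ≤
      power P₀ (normalizedSum f) (normalTail zα) (mixture P₀ P₁ s) n :=
    measureReal_mono fun x hx => lt_of_le_of_lt hn.2 hx
  linarith

/-- Uniformity in `n` comes from compactness. Counterexamples `(s k, n k)` with `s k → 0` have `n k
→ ∞`, and `s k √(n k)` is eventually confined to some `[d, C]` by the Chebyshev bound; along a
subsequence it converges to some `d' ≥ d`, where the normal limit gives too much power. -/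
lemma eventually_forall_le_power (hf : Measurable f) (h₀ : MemLp f 2 P₀)
    (h₁ : MemLp f 2 P₁) (hm : ∫ x, f x ∂P₀ = 0) (hσ : 0 < σ)
    (hv : ∫ x, f x ^ 2 ∂P₀ = σ ^ 2) (hμ : 0 < ∫ x, f x ∂P₁) (hβ : normalTail zβ < 1) {d : ℝ}
    (hd : 0 < d) (hlt : σ * (zα - zβ) < d * ∫ x, f x ∂P₁) :
    ∀ᶠ s in 𝓝[>] (0 : ℝ), ∀ n : ℕ, d ≤ s * √(n : ℝ) →
      normalTail zβ ≤ power P₀ (normalizedSum f) (normalTail zα) (mixture P₀ P₁ s) n := by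
  by_contra hcon
  rw [not_eventually] at hcon
  obtain ⟨s, hs0, hs⟩ := exists_seq_forall_of_frequently
    (hcon.and_eventually (Ioo_mem_nhdsGT (zero_lt_one' ℝ)))
  have hs0' : Tendsto s atTop (𝓝 0) := tendsto_nhds_of_tendsto_nhdsWithin hs0
  have hsI : ∀ k, s k ∈ Set.Icc (0 : ℝ) 1 := fun k => Set.Ioo_subset_Icc_self (hs k).2
  have hbad := fun k => (hs k).1
  push Not at hbad
  choose n hdn hpow using hbad
  have hn : Tendsto n atTop atTop := by
    have h1 : Tendsto (fun k => d / s k) atTop atTop :=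
      (tendsto_inv_nhdsGT_zero.comp hs0).const_mul_atTop hd
    have h2 : Tendsto (fun k => √(n k : ℝ)) atTop atTop :=
      tendsto_atTop_mono (fun k => by
        rw [div_le_iff₀ (hs k).2.1, mul_comm]; exact hdn k) h1
    refine tendsto_natCast_atTop_iff (R := ℝ).1 (((tendsto_pow_atTop two_ne_zero).comp h2).congr
      fun k => ?_)
    exact Real.sq_sqrt (Nat.cast_nonneg _)
  obtain ⟨C, hC⟩ := exists_bound_of_power_lt (zα := zα) hf h₀ h₁ hm hσ hv hμ hβ
  have hmem : ∃ᶠ k in atTop, s k * √(n k : ℝ) ∈ Set.Icc d C :=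
    ((hn.eventually hC).mono fun k hk => ⟨hdn k, hk (s k) (hsI k) (hpow k)⟩).frequently
  obtain ⟨d', hd', φ, hφ, hlim⟩ := tendsto_subseq_of_frequently_bounded
    (Metric.isBounded_Icc d C) hmem
  rw [isClosed_Icc.closure_eq] at hd'
  have := eventually_lt_power (zα := zα) (zβ := zβ) hf h₀ h₁ hm hσ hv (hn.comp hφ.tendsto_atTop)
    (fun k => hsI (φ k)) (hs0'.comp hφ.tendsto_atTop) hlim
    (hlt.trans_le (mul_le_mul_of_nonneg_right hd'.1 hμ.le))
  obtain ⟨k, hk⟩ := this.exists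
  exact absurd hk (not_lt.2 (hpow (φ k)).le)

lemma eventually_le_mul_minSampleSize (hf : Measurable f) (h₀ : MemLp f 2 P₀)
    (h₁ : MemLp f 2 P₁) (hm : ∫ x, f x ∂P₀ = 0) (hσ : 0 < σ)
    (hv : ∫ x, f x ^ 2 ∂P₀ = σ ^ 2) {d : ℝ} (hd : 0 < d)
    (hlt : d * ∫ x, f x ∂P₁ < σ * (zα - zβ)) :
    ∀ᶠ s in 𝓝[>] (0 : ℝ), ENNReal.ofReal (d ^ 2) ≤ ENNReal.ofReal (s ^ 2) *
      minSampleSize P₀ (normalizedSum f) (normalTail zα) (normalTail zβ) (mixture P₀ P₁ s) := by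
  by_contra hcon
  rw [not_eventually] at hcon
  obtain ⟨s, hs0, hs⟩ := exists_seq_forall_of_frequently
    (hcon.and_eventually (Ioo_mem_nhdsGT (zero_lt_one' ℝ)))
  have hs0' : Tendsto s atTop (𝓝 0) := tendsto_nhds_of_tendsto_nhdsWithin hs0
  have hsI : ∀ k, s k ∈ Set.Icc (0 : ℝ) 1 := fun k => Set.Ioo_subset_Icc_self (hs k).2
  -- At this size `s √n → d`, so the test still fails, while `s² (n + 1) ≥ d²` makes the resulting
  -- bound `n + 1 ≤ N` exact, without an error term.
  set n : ℕ → ℕ := fun k => ⌊d ^ 2 / s k ^ 2⌋₊ with hndef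
  have hsq : ∀ k, 0 < s k ^ 2 := fun k => pow_pos (hs k).2.1 2
  have hupper : ∀ k, s k ^ 2 * n k ≤ d ^ 2 := fun k => by
    have := Nat.floor_le (show 0 ≤ d ^ 2 / s k ^ 2 by positivity)
    rw [le_div_iff₀ (hsq k)] at this
    linarith
  have hlower : ∀ k, d ^ 2 ≤ s k ^ 2 * (n k + 1) := fun k => by
    have := (Nat.lt_floor_add_one (d ^ 2 / s k ^ 2)).le
    rw [div_le_iff₀ (hsq k)] at this
    linarith
  have hn : Tendsto n atTop atTop := by
    refine tendsto_nat_floor_atTop.comp ?_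
    have h1 : Tendsto (fun k => (d * (s k)⁻¹)) atTop atTop :=
      (tendsto_inv_nhdsGT_zero.comp hs0).const_mul_atTop hd
    refine ((tendsto_pow_atTop two_ne_zero).comp h1).congr fun k => ?_
    simp only [Function.comp]
    field_simp
  have hlim2 : Tendsto (fun k => s k ^ 2 * (n k : ℝ)) atTop (𝓝 (d ^ 2)) := by
    refine tendsto_of_tendsto_of_tendsto_of_le_of_le (g := fun k => d ^ 2 - s k ^ 2) ?_
      tendsto_const_nhds (fun k => ?_) hupper
    · simpa using (hs0'.pow 2).const_sub (d ^ 2)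
    · have := hlower k
      simp only
      linarith
  have hlim : Tendsto (fun k => s k * √(n k : ℝ)) atTop (𝓝 d) := by
    have := (Real.continuous_sqrt.tendsto _).comp hlim2
    rw [Real.sqrt_sq hd.le] at this
    refine this.congr fun k => ?_
    simp only [Function.comp]
    rw [Real.sqrt_mul (hsq k).le, Real.sqrt_sq (hsI k).1]
  obtain ⟨k, hk⟩ := (eventually_power_lt (zα := zα) (zβ := zβ) hf h₀ h₁ hm hσ hv hn hsI hs0' hlim
    hlt).exists
  refine (hs k).1 ?_
  calc ENNReal.ofReal (d ^ 2) ≤ ENNReal.ofReal (s k ^ 2 * (n k + 1)) :=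
        ENNReal.ofReal_le_ofReal (hlower k)
    _ = ENNReal.ofReal (s k ^ 2) * ((n k + 1 : ℕ) : ℝ≥0∞) := by
        rw [ENNReal.ofReal_mul (hsq k).le, ← ENNReal.ofReal_natCast (n k + 1)]
        push_cast; rfl
    _ ≤ _ := mul_le_mul_right (le_minSampleSize hk) _

lemma eventually_mul_minSampleSize_le (hf : Measurable f) (h₀ : MemLp f 2 P₀)
    (h₁ : MemLp f 2 P₁) (hm : ∫ x, f x ∂P₀ = 0) (hσ : 0 < σ)
    (hv : ∫ x, f x ^ 2 ∂P₀ = σ ^ 2) (hμ : 0 < ∫ x, f x ∂P₁) (hβ : normalTail zβ < 1) {d : ℝ}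
    (hd : 0 < d) (hlt : σ * (zα - zβ) < d * ∫ x, f x ∂P₁) :
    ∀ᶠ s in 𝓝[>] (0 : ℝ), ENNReal.ofReal (s ^ 2) *
      minSampleSize P₀ (normalizedSum f) (normalTail zα) (normalTail zβ) (mixture P₀ P₁ s)
        ≤ ENNReal.ofReal (d ^ 2 + s ^ 2) := by
  filter_upwards [eventually_forall_le_power hf h₀ h₁ hm hσ hv hμ hβ hd hlt, self_mem_nhdsWithin]
    with s hs hs0
  have hs0 : 0 < s := hs0
  have hsq : 0 < s ^ 2 := by positivity
  have hN : minSampleSize P₀ (normalizedSum f) (normalTail zα) (normalTail zβ) (mixture P₀ P₁ s)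
      ≤ (⌈d ^ 2 / s ^ 2⌉₊ : ℕ) := by
    refine minSampleSize_le (Nat.one_le_ceil_iff.2 (by positivity)) fun n hn => hs n ?_
    have h1 := (Nat.le_ceil (d ^ 2 / s ^ 2)).trans (Nat.cast_le (α := ℝ).2 hn)
    rw [div_le_iff₀ hsq] at h1
    have h2 : (s * √(n : ℝ)) ^ 2 = n * s ^ 2 := by
      rw [mul_pow, Real.sq_sqrt (by positivity)]; ring
    exact le_of_sq_le_sq (by rw [h2]; exact h1) (by positivity)
  calc _ ≤ ENNReal.ofReal (s ^ 2) * (⌈d ^ 2 / s ^ 2⌉₊ : ℕ) := mul_le_mul_right hN _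
    _ = ENNReal.ofReal (s ^ 2 * ⌈d ^ 2 / s ^ 2⌉₊) := by
        rw [ENNReal.ofReal_mul hsq.le, ENNReal.ofReal_natCast]
    _ ≤ _ := by
        refine ENNReal.ofReal_le_ofReal ?_
        have := (Nat.ceil_lt_add_one (show 0 ≤ d ^ 2 / s ^ 2 by positivity)).le
        calc s ^ 2 * (⌈d ^ 2 / s ^ 2⌉₊ : ℝ) ≤ s ^ 2 * (d ^ 2 / s ^ 2 + 1) :=
              mul_le_mul_of_nonneg_left this hsq.le
          _ = d ^ 2 + s ^ 2 := by field_simp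

/-- The critical drift `c` solves `c μ = σ (zα - zβ)`; the one-sided bounds for `d < c` and `d > c`
close up as `d → c`. -/
theorem tendsto_mul_minSampleSize (hf : Measurable f) (h₀ : MemLp f 2 P₀)
    (h₁ : MemLp f 2 P₁) (hm : ∫ x, f x ∂P₀ = 0) (hσ : 0 < σ)
    (hv : ∫ x, f x ^ 2 ∂P₀ = σ ^ 2) (hμ : 0 < ∫ x, f x ∂P₁) (hβ : normalTail zβ < 1)
    (hz : zβ < zα) :
    Tendsto (fun s => ENNReal.ofReal (s ^ 2) *
      minSampleSize P₀ (normalizedSum f) (normalTail zα) (normalTail zβ) (mixture P₀ P₁ s))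
      (𝓝[>] 0) (𝓝 (ENNReal.ofReal ((σ * (zα - zβ) / ∫ x, f x ∂P₁) ^ 2))) := by
  set c := σ * (zα - zβ) / ∫ x, f x ∂P₁ with hc
  have hc0 : 0 < c := div_pos (mul_pos hσ (sub_pos.2 hz)) hμ
  have hcont : Continuous fun d : ℝ => ENNReal.ofReal (d ^ 2) :=
    ENNReal.continuous_ofReal.comp (continuous_pow 2)
  refine tendsto_order.2 ⟨fun a ha => ?_, fun a ha => ?_⟩
  · obtain ⟨d, hda, hd0, hdc⟩ := (((hcont.tendsto c).mono_left nhdsWithin_le_nhds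
      |>.eventually_const_lt ha).and (Ioo_mem_nhdsLT hc0)).exists
    filter_upwards [eventually_le_mul_minSampleSize hf h₀ h₁ hm hσ hv hd0
      ((lt_div_iff₀ hμ).1 hdc)] with s hs
    exact hda.trans_le hs
  · obtain ⟨d, hda, hdc⟩ := (((hcont.tendsto c).mono_left nhdsWithin_le_nhds
      |>.eventually_lt_const ha).and (self_mem_nhdsWithin (s := Set.Ioi c))).exists
    have hdc : c < d := hdc
    have hsmall : Tendsto (fun s : ℝ => ENNReal.ofReal (d ^ 2 + s ^ 2)) (𝓝[>] 0)
        (𝓝 (ENNReal.ofReal (d ^ 2))) := by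
      have : Continuous fun s : ℝ => ENNReal.ofReal (d ^ 2 + s ^ 2) :=
        ENNReal.continuous_ofReal.comp (by fun_prop)
      simpa using (this.tendsto 0).mono_left nhdsWithin_le_nhds
    filter_upwards [eventually_mul_minSampleSize_le hf h₀ h₁ hm hσ hv hμ hβ (hc0.trans hdc)
      ((div_lt_iff₀ hμ).1 hdc), hsmall.eventually_lt_const hda] with s hs hs'
    exact hs.trans_lt hs'

theorem tendsto_relativeEfficiency {g : 𝓧 → ℝ} {α β σ' : ℝ}
    (hα : 0 < α) (hαβ : α < β) (hβ : β < 1)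
    (hf : Measurable f) (h₀ : MemLp f 2 P₀) (h₁ : MemLp f 2 P₁) (hm : ∫ x, f x ∂P₀ = 0)
    (hσ : 0 < σ) (hv : ∫ x, f x ^ 2 ∂P₀ = σ ^ 2) (hμ : 0 < ∫ x, f x ∂P₁)
    (hg : Measurable g) (hg₀ : MemLp g 2 P₀) (hg₁ : MemLp g 2 P₁) (hgm : ∫ x, g x ∂P₀ = 0)
    (hσ' : 0 < σ') (hgv : ∫ x, g x ^ 2 ∂P₀ = σ' ^ 2) (hgμ : 0 < ∫ x, g x ∂P₁) :
    Tendsto (fun s => relativeEfficiency P₀ (normalizedSum f) (normalizedSum g) α β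
      (mixture P₀ P₁ s)) (𝓝[>] 0)
      (𝓝 (ENNReal.ofReal (((∫ x, f x ∂P₁) / σ) ^ 2 / ((∫ x, g x ∂P₁) / σ') ^ 2))) := by
  obtain ⟨zα, rfl⟩ := exists_normalTail_eq hα (hαβ.trans hβ)
  obtain ⟨zβ, rfl⟩ := exists_normalTail_eq (hα.trans hαβ) hβ
  have hz : zβ < zα := strictAnti_normalTail.lt_iff_gt.1 hαβ
  have hz' : 0 < zα - zβ := sub_pos.2 hz
  have hT := tendsto_mul_minSampleSize hf h₀ h₁ hm hσ hv hμ hβ hz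
  have hV := tendsto_mul_minSampleSize hg hg₀ hg₁ hgm hσ' hgv hgμ hβ hz
  have hpos : 0 < (σ * (zα - zβ) / ∫ x, f x ∂P₁) ^ 2 := by positivity
  have h := ENNReal.Tendsto.div hV (Or.inr (ENNReal.ofReal_pos.2 hpos).ne') hT (Or.inl ENNReal.ofReal_ne_top)
  rw [← ENNReal.ofReal_div_of_pos hpos] at h
  have e : (σ' * (zα - zβ) / ∫ x, g x ∂P₁) ^ 2 / (σ * (zα - zβ) / ∫ x, f x ∂P₁) ^ 2
      = ((∫ x, f x ∂P₁) / σ) ^ 2 / ((∫ x, g x ∂P₁) / σ') ^ 2 := by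
    field_simp
  rw [e] at h
  refine h.congr' ?_
  filter_upwards [self_mem_nhdsWithin] with s hs
  have hs : 0 < s := hs
  -- The common factor `s²` is positive and finite, so it cancels even if a sample size is infinite.
  exact ENNReal.mul_div_mul_left _ _ (by simpa using hs.ne') ENNReal.ofReal_ne_top

end SampleSize

end

end Pitman

namespace Pitman

noncomputable section

/-! ### Linear contaminations are paths in the Hellinger sense. -/

section Hellinger

variable {𝓧 : Type*} [MeasurableSpace 𝓧] {P₀ P₁ : Measure 𝓧} [IsProbabilityMeasure P₀]
  [IsProbabilityMeasure P₁]

/-- Factor `a - b = (√a - √b)(√a + √b)` and use `|√a - √b| ≤ √a + √b`. -/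
lemma sq_sqrt_sub_sqrt_le {a b : ℝ} (ha : 0 ≤ a) (hb : 0 ≤ b) : (√a - √b) ^ 2 ≤ |a - b| := by
  have h : |a - b| = |√a - √b| * |√a + √b| := by
    rw [← abs_mul]
    congr 1
    nlinarith [Real.sq_sqrt ha, Real.sq_sqrt hb]
  rw [h, ← sq_abs, pow_two]
  refine mul_le_mul_of_nonneg_left ?_ (abs_nonneg _)
  rw [abs_of_nonneg (add_nonneg (Real.sqrt_nonneg a) (Real.sqrt_nonneg b))]
  exact abs_le.2 ⟨by linarith [Real.sqrt_nonneg a], by linarith [Real.sqrt_nonneg b]⟩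

/-- The densities of the mixture and of `P₀` differ by `s (p₁ - p₀)`, whose L¹ norm is at most `2
s`. -/
lemma hellingerDist_mixture_le {s : ℝ} (hs : s ∈ Set.Icc (0 : ℝ) 1) :
    hellingerDist (mixture P₀ P₁ s) P₀ ≤ √(2 * s) := by
  have hprob := isProbabilityMeasure_mixture (P₀ := P₀) (P₁ := P₁) hs
  refine Real.sqrt_le_sqrt ?_
  set ν := mixture P₀ P₁ s + P₀ with hν
  have hd : ∀ᵐ x ∂ν, ((mixture P₀ P₁ s).rnDeriv ν x).toReal =
      (1 - s) * (P₀.rnDeriv ν x).toReal + s * (P₁.rnDeriv ν x).toReal := by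
    have e0 : IsFiniteMeasure (ENNReal.ofReal (1 - s) • P₀) :=
      P₀.smul_finite ENNReal.ofReal_ne_top
    have e1 : IsFiniteMeasure (ENNReal.ofReal s • P₁) := P₁.smul_finite ENNReal.ofReal_ne_top
    have h1 := Measure.rnDeriv_add (ENNReal.ofReal (1 - s) • P₀) (ENNReal.ofReal s • P₁) ν
    have h2 := Measure.rnDeriv_smul_left_of_ne_top P₀ ν (ENNReal.ofReal_ne_top (r := 1 - s))
    have h3 := Measure.rnDeriv_smul_left_of_ne_top P₁ ν (ENNReal.ofReal_ne_top (r := s))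
    filter_upwards [h1, h2, h3, Measure.rnDeriv_lt_top P₀ ν, Measure.rnDeriv_lt_top P₁ ν]
      with x h1 h2 h3 h4 h5
    rw [mixture, h1, Pi.add_apply, h2, h3]
    simp only [Pi.smul_apply, smul_eq_mul]
    rw [ENNReal.toReal_add (ENNReal.mul_ne_top ENNReal.ofReal_ne_top h4.ne)
      (ENNReal.mul_ne_top ENNReal.ofReal_ne_top h5.ne), ENNReal.toReal_mul, ENNReal.toReal_mul,
      ENNReal.toReal_ofReal (by linarith [hs.2]), ENNReal.toReal_ofReal hs.1]
  have hmass (P : Measure 𝓧) [IsProbabilityMeasure P] :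
      ∫ x, (P.rnDeriv ν x).toReal ∂ν ≤ 1 := by
    simpa using Measure.setIntegral_toReal_rnDeriv_le (μ := P) (ν := ν) (s := Set.univ)
      (measure_ne_top _ _)
  have hi₀ : Integrable (fun x => (P₀.rnDeriv ν x).toReal) ν := Measure.integrable_toReal_rnDeriv
  have hi₁ : Integrable (fun x => (P₁.rnDeriv ν x).toReal) ν := Measure.integrable_toReal_rnDeriv
  calc ∫ x, (√((mixture P₀ P₁ s).rnDeriv ν x).toReal - √(P₀.rnDeriv ν x).toReal) ^ 2 ∂ν
      ≤ ∫ x, s * ((P₁.rnDeriv ν x).toReal + (P₀.rnDeriv ν x).toReal) ∂ν := by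
        refine integral_mono_of_nonneg (.of_forall fun x => sq_nonneg _)
          ((hi₁.add hi₀).const_mul s) ?_
        filter_upwards [hd] with x hx
        refine (sq_sqrt_sub_sqrt_le ENNReal.toReal_nonneg ENNReal.toReal_nonneg).trans ?_
        rw [hx]
        have a0 : 0 ≤ (P₀.rnDeriv ν x).toReal := ENNReal.toReal_nonneg
        have a1 : 0 ≤ (P₁.rnDeriv ν x).toReal := ENNReal.toReal_nonneg
        rw [abs_le]
        constructor <;> nlinarith [hs.1, mul_nonneg hs.1 a0, mul_nonneg hs.1 a1]
    _ = s * (∫ x, (P₁.rnDeriv ν x).toReal ∂ν + ∫ x, (P₀.rnDeriv ν x).toReal ∂ν) := by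
        rw [integral_const_mul, integral_add hi₁ hi₀]
    _ ≤ 2 * s := by nlinarith [hs.1, hmass P₀, hmass P₁]

lemma isPath_mixture : IsPath P₀ (mixture P₀ P₁) where
  isProbabilityMeasure _ hs := isProbabilityMeasure_mixture hs
  start := mixture_zero
  dominated := by
    refine ⟨P₀ + P₁, inferInstance, fun s _ => ?_⟩
    refine Measure.AbsolutelyContinuous.mk fun A _ hA => ?_
    simp only [Measure.add_apply, add_eq_zero] at hA
    simp [mixture, hA.1, hA.2]
  tendsto_hellingerDist := by
    have hlim : Tendsto (fun s : ℝ => √(2 * s)) (𝓝[>] 0) (𝓝 0) := by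
      have : Continuous fun s : ℝ => √(2 * s) := by fun_prop
      simpa using (this.tendsto 0).mono_left nhdsWithin_le_nhds
    refine squeeze_zero' (.of_forall fun s => Real.sqrt_nonneg _) ?_ hlim
    filter_upwards [Ioo_mem_nhdsGT (zero_lt_one' ℝ)] with s hs
    exact hellingerDist_mixture_le (Set.Ioo_subset_Icc_self hs)

end Hellinger

/-! ### Moments of beta distributions. -/

section BetaMoments

variable {p q : ℝ}

lemma betaPDFReal_nonneg (hp : 0 < p) (hq : 0 < q) (x : ℝ) : 0 ≤ betaPDFReal p q x := by
  by_cases h : 0 < x ∧ x < 1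
  · exact (betaPDFReal_pos h.1 h.2 hp hq).le
  · simp [betaPDFReal, h]

lemma integral_betaPDFReal (hp : 0 < p) (hq : 0 < q) : ∫ x, betaPDFReal p q x = 1 := by
  rw [integral_eq_lintegral_of_nonneg_ae (.of_forall (betaPDFReal_nonneg hp hq)) (by fun_prop)]
  have := lintegral_betaPDF_eq_one hp hq
  unfold betaPDF at this
  rw [this]
  simp

lemma integral_betaMeasure (hp : 0 < p) (hq : 0 < q) (g : ℝ → ℝ) :
    ∫ x, g x ∂betaMeasure p q = ∫ x, betaPDFReal p q x * g x := by
  have hm : Measurable (betaPDF p q) := (measurable_betaPDFReal p q).ennreal_ofReal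
  rw [betaMeasure, integral_withDensity_eq_integral_toReal_smul hm (.of_forall fun x => ENNReal.ofReal_lt_top)]
  refine integral_congr_ae (.of_forall fun x => ?_)
  simp [betaPDF, ENNReal.toReal_ofReal (betaPDFReal_nonneg hp hq x)]

lemma ae_betaMeasure_mem_Ioo : ∀ᵐ x ∂betaMeasure p q, x ∈ Set.Ioo (0 : ℝ) 1 := by
  have hm : Measurable (betaPDF p q) := (measurable_betaPDFReal p q).ennreal_ofReal
  rw [betaMeasure, ae_withDensity_iff hm]
  refine .of_forall fun x hx => ?_
  by_contra h
  exact hx (by simp [betaPDF, betaPDFReal, show ¬(0 < x ∧ x < 1) from h])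

lemma beta_add_one (hp : 0 < p) (hq : 0 < q) : beta (p + 1) q = p / (p + q) * beta p q := by
  have h : p + 1 + q = (p + q) + 1 := by ring
  have hpq : p + q ≠ 0 := (add_pos hp hq).ne'
  have hG := (Real.Gamma_pos_of_pos (add_pos hp hq)).ne'
  rw [beta, beta, h, Real.Gamma_add_one hp.ne', Real.Gamma_add_one hpq]
  field_simp

/-- Multiplying the density by `x ^ k` gives a multiple of the beta density with first parameter `p
+ k`, which integrates to one. -/
lemma integral_pow_betaMeasure (hp : 0 < p) (hq : 0 < q) (k : ℕ) :
    ∫ x, x ^ k ∂betaMeasure p q = beta (p + k) q / beta p q := by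
  have hpk : 0 < p + k := by positivity
  have hb := (beta_pos hp hq).ne'
  have hbk := (beta_pos hpk hq).ne'
  have h : (fun x => betaPDFReal p q x * x ^ k) =
      fun x => beta (p + k) q / beta p q * betaPDFReal (p + k) q x := by
    ext x
    by_cases hx : 0 < x ∧ x < 1
    · rw [betaPDFReal, betaPDFReal, if_pos hx, if_pos hx,
        show p + k - 1 = (p - 1) + (k : ℝ) by ring, Real.rpow_add hx.1, Real.rpow_natCast]
      field_simp
    · simp [betaPDFReal, hx]
  rw [integral_betaMeasure hp hq, h, integral_const_mul, integral_betaPDFReal hpk hq, mul_one]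

lemma integral_pow_succ_betaMeasure (hp : 0 < p) (hq : 0 < q) (k : ℕ) :
    ∫ x, x ^ (k + 1) ∂betaMeasure p q =
      (p + k) / (p + k + q) * ∫ x, x ^ k ∂betaMeasure p q := by
  have hpk : 0 < p + k := by positivity
  rw [integral_pow_betaMeasure hp hq, integral_pow_betaMeasure hp hq, Nat.cast_succ, ← add_assoc,
    beta_add_one hpk hq, mul_div_assoc]

lemma integrable_pow_betaMeasure (hp : 0 < p) (hq : 0 < q) (k : ℕ) :
    Integrable (fun x => x ^ k) (betaMeasure p q) := by
  have := isProbabilityMeasureBeta hp hq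
  refine Integrable.of_bound (by fun_prop) 1 ?_
  filter_upwards [ae_betaMeasure_mem_Ioo] with x hx
  rw [norm_pow, Real.norm_of_nonneg hx.1.le]
  exact pow_le_one₀ hx.1.le hx.2.le

lemma integral_pow_one_betaMeasure (hp : 0 < p) (hq : 0 < q) :
    ∫ x, x ^ 1 ∂betaMeasure p q = p / (p + q) := by
  have := isProbabilityMeasureBeta hp hq
  rw [integral_pow_succ_betaMeasure hp hq]
  simp

lemma integral_pow_two_betaMeasure (hp : 0 < p) (hq : 0 < q) :
    ∫ x, x ^ 2 ∂betaMeasure p q = (p + 1) / (p + 1 + q) * (p / (p + q)) := by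
  rw [integral_pow_succ_betaMeasure hp hq, integral_pow_one_betaMeasure hp hq]
  simp

lemma integral_pow_four_uniform : ∫ x, x ^ 4 ∂betaMeasure 1 1 = 1 / 5 := by
  rw [integral_pow_succ_betaMeasure one_pos one_pos, integral_pow_succ_betaMeasure one_pos one_pos,
    integral_pow_two_betaMeasure one_pos one_pos]
  norm_num

lemma memLp_pow_sub_const_betaMeasure (hp : 0 < p) (hq : 0 < q) (k : ℕ) (c : ℝ) :
    MemLp (fun x => x ^ k - c) 2 (betaMeasure p q) := by
  have := isProbabilityMeasureBeta hp hq
  have h : MemLp (fun x => x ^ k) 2 (betaMeasure p q) := by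
    refine (memLp_two_iff_integrable_sq (by fun_prop)).2 ?_
    simp_rw [← pow_mul]
    exact integrable_pow_betaMeasure hp hq _
  exact h.sub (memLp_const c)

lemma integral_pow_sub_const_betaMeasure (hp : 0 < p) (hq : 0 < q) (k : ℕ) (c : ℝ) :
    ∫ x, (x ^ k - c) ∂betaMeasure p q = ∫ x, x ^ k ∂betaMeasure p q - c := by
  have := isProbabilityMeasureBeta hp hq
  rw [integral_sub (integrable_pow_betaMeasure hp hq k) (integrable_const c)]
  simp

lemma integral_sq_pow_sub_const_betaMeasure (hp : 0 < p) (hq : 0 < q) (k : ℕ) (c : ℝ) :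
    ∫ x, (x ^ k - c) ^ 2 ∂betaMeasure p q =
      ∫ x, x ^ (2 * k) ∂betaMeasure p q - 2 * c * ∫ x, x ^ k ∂betaMeasure p q + c ^ 2 := by
  have := isProbabilityMeasureBeta hp hq
  have h : (fun x : ℝ => (x ^ k - c) ^ 2) = fun x => x ^ (2 * k) - 2 * c * x ^ k + c ^ 2 := by
    ext x; ring
  have hi := integrable_pow_betaMeasure hp hq
  have hi' : Integrable (fun x => x ^ (2 * k) - 2 * c * x ^ k) (betaMeasure p q) :=
    (hi _).sub ((hi _).const_mul _)
  rw [h, integral_add hi' (integrable_const _), integral_sub (hi _) ((hi _).const_mul _), integral_const_mul]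
  simp

end BetaMoments

lemma statT_eq_normalizedSum : statT = normalizedSum fun x : ℝ => x ^ 2 - 1 / 3 := rfl

/-- The exponent `1` is kept so that the same moment lemmas for `x ^ k - c` serve both statistics.
-/
lemma statV_eq_normalizedSum : statV = normalizedSum fun x : ℝ => x ^ 1 - 1 / 2 := by
  ext n x
  simp only [statV, normalizedSum, pow_one, Finset.sum_sub_distrib, Finset.sum_const,
    Finset.card_univ, Fintype.card_fin, nsmul_eq_mul]
  rcases Nat.eq_zero_or_pos n with rfl | hn
  · simp
  · have hn' : (0 : ℝ) < n := by exact_mod_cast hn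
    have hs : (0 : ℝ) < √(n : ℝ) := Real.sqrt_pos.2 hn'
    have hsq := Real.sq_sqrt hn'.le
    rw [eq_div_iff hs.ne', mul_right_comm, ← pow_two, hsq]
    field_simp

end

end Pitman

theorem mainTheorem2 (p q : ℝ) (hq : 0 < q) (hpq : q < p) (hτ : 0 < Pitman.tau p q)
    (α β : ℝ) (hα : 0 < α) (hαβ : α < β) (hβ : β < 1) :
    Pitman.HasPitmanEfficiency (ProbabilityTheory.betaMeasure 1 1)
      (fun s => Pitman.contaminatedBeta p q s) Pitman.statT Pitman.statV α β
      (ENNReal.ofReal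
        (5 * Pitman.tau p q ^ 2 / (12 * (p - q) ^ 2 * (p + q + 1) ^ 2))) := by
  have hp : 0 < p := hq.trans hpq
  have hsum : 0 < p + q := add_pos hp hq
  have := isProbabilityMeasureBeta (one_pos (α := ℝ)) (one_pos (α := ℝ))
  have := isProbabilityMeasureBeta hp hq
  -- `contaminatedBeta` is definitionally the mixture of the two beta measures.
  refine ⟨Pitman.isPath_mixture, ?_⟩
  rw [Pitman.statT_eq_normalizedSum, Pitman.statV_eq_normalizedSum]
  have hμT : ∫ x, (x ^ 2 - 1 / 3) ∂betaMeasure p q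
      = Pitman.tau p q / (3 * (p + q) * (p + q + 1)) := by
    rw [Pitman.integral_pow_sub_const_betaMeasure hp hq,
      Pitman.integral_pow_two_betaMeasure hp hq, Pitman.tau]
    have : p + 1 + q ≠ 0 := by positivity
    field_simp
    ring
  have hμV : ∫ x, (x ^ 1 - 1 / 2) ∂betaMeasure p q = (p - q) / (2 * (p + q)) := by
    rw [Pitman.integral_pow_sub_const_betaMeasure hp hq,
      Pitman.integral_pow_one_betaMeasure hp hq]
    field_simp
    ring
  have hsub : 0 < p - q := sub_pos.2 hpq
  have h := Pitman.tendsto_relativeEfficiency (P₀ := betaMeasure 1 1) (P₁ := betaMeasure p q)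
    (f := fun x : ℝ => x ^ 2 - 1 / 3) (g := fun x : ℝ => x ^ 1 - 1 / 2)
    -- Uniform variances of `X²` and `X`: `1/5 - 1/9 = 4/45` and `1/3 - 1/4 = 1/12`. The conditions
    -- `τ > 0` and `p > q` are positivity of the respective mean shifts.
    (σ := √(4 / 45)) (σ' := √(1 / 12)) hα hαβ hβ (by fun_prop)
    (Pitman.memLp_pow_sub_const_betaMeasure one_pos one_pos 2 _)
    (Pitman.memLp_pow_sub_const_betaMeasure hp hq 2 _)
    (by rw [Pitman.integral_pow_sub_const_betaMeasure one_pos one_pos,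
          Pitman.integral_pow_two_betaMeasure one_pos one_pos]; norm_num)
    (by positivity)
    (by rw [Pitman.integral_sq_pow_sub_const_betaMeasure one_pos one_pos,
          Pitman.integral_pow_four_uniform, Pitman.integral_pow_two_betaMeasure one_pos one_pos,
          Real.sq_sqrt (by norm_num)]; norm_num)
    (by rw [hμT]; positivity) (by fun_prop)
    (Pitman.memLp_pow_sub_const_betaMeasure one_pos one_pos 1 _)
    (Pitman.memLp_pow_sub_const_betaMeasure hp hq 1 _)
    (by rw [Pitman.integral_pow_sub_const_betaMeasure one_pos one_pos,
          Pitman.integral_pow_one_betaMeasure one_pos one_pos]; norm_num)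
    (by positivity)
    (by rw [Pitman.integral_sq_pow_sub_const_betaMeasure one_pos one_pos,
          Pitman.integral_pow_two_betaMeasure one_pos one_pos,
          Pitman.integral_pow_one_betaMeasure one_pos one_pos,
          Real.sq_sqrt (by norm_num)]; norm_num)
    (by rw [hμV]; positivity)
  have e : (Pitman.tau p q / (3 * (p + q) * (p + q + 1)) / √(4 / 45)) ^ 2 /
      ((p - q) / (2 * (p + q)) / √(1 / 12)) ^ 2
      = 5 * Pitman.tau p q ^ 2 / (12 * (p - q) ^ 2 * (p + q + 1) ^ 2) := by
    have h1 : √(4 / 45 : ℝ) ^ 2 = 4 / 45 := Real.sq_sqrt (by norm_num)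
    have h2 : √(1 / 12 : ℝ) ^ 2 = 1 / 12 := Real.sq_sqrt (by norm_num)
    rw [div_pow _ √(4 / 45), div_pow _ √(1 / 12), h1, h2]
    field_simp
    ring
  rw [hμT, hμV, e] at h
  exact h
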